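/- There are absolute constants $c, C > 0$ such that the following holds. Here a frame is a tuple $V=(v_1,\ldots,v_n)$ of vectors in $\mathbb{R}^d$ with the Euclidean norm. It is called doubly balanced if, with $s=\sum_{i=1}^n \|v_i\|^2$, one has $\sum_{i=1}^n v_i v_i^{T} = \frac{s}{d} I_d$ and $\|v_i\|^2 = \frac{s}{n}$ for every $i$. Its angle is $\theta(V) = \max_{i\neq j} \langle v_i, v_j\rangle^2$ (and $\theta(V)=0$ if $n \le 1$), and $\log$ is the natural logarithm. (1) For all integers $d \ge 1$ and $n \ge c\, d^{4/3}$ there is a doubly balanced frame $V=(v_1,\ldots,v_n)$ of unit vectors in $\mathbb{R}^d$ with $$\theta(V) \le C\left(\frac{\log n}{d} + \frac{d \log^3 d}{n}\right).$$ (2) For every integer $d \ge 1$ there is a doubly balanced frame $V=(v_1,\ldots,v_{d^2})$ of $n=d^2$ unit vectors in $\mathbb{R}^d$ with $$\theta(V) \le C\,\frac{\log^3 d}{d}.$$ -/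

import Mathlib

namespace FrameScaling

/-- A frame: a tuple of `n` vectors in `ℝ^d` with the Euclidean norm. -/
abbrev Frame (n d : ℕ) : Type := Fin n → EuclideanSpace ℝ (Fin d)

/-- The size `s(U) = ∑ i, ‖u i‖²` of a frame. -/
noncomputable def size {n d : ℕ} (U : Frame n d) : ℝ := ∑ i, ‖U i‖ ^ 2

/-- The frame operator `∑ i, u i (u i)ᵀ`, as a `d × d` matrix. -/
noncomputable def frameOperator {n d : ℕ} (U : Frame n d) : Matrix (Fin d) (Fin d) ℝ :=
  ∑ i, Matrix.vecMulVec (U i).ofLp (U i).ofLp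

/-- The `n × n` diagonal matrix of the squared norms of the vectors of a frame. -/
noncomputable def normMatrix {n d : ℕ} (U : Frame n d) : Matrix (Fin n) (Fin n) ℝ :=
  Matrix.diagonal fun i => ‖U i‖ ^ 2

/-- `ε`-nearly doubly balanced frames:
`(1 - ε) (s/d) I ≼ ∑ i, u i (u i)ᵀ ≼ (1 + ε) (s/d) I` and
`(1 - ε) (s/n) I ≼ diag (‖u i‖²) ≼ (1 + ε) (s/n) I`. The Loewner order `A ≼ B` is written as
`(B - A).PosSemidef`. -/
structure IsNearlyDoublyBalanced {n d : ℕ} (ε : ℝ) (U : Frame n d) : Prop where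
  frameOperator_lower :
    (frameOperator U - ((1 - ε) * (size U / d)) • (1 : Matrix (Fin d) (Fin d) ℝ)).PosSemidef
  frameOperator_upper :
    (((1 + ε) * (size U / d)) • (1 : Matrix (Fin d) (Fin d) ℝ) - frameOperator U).PosSemidef
  normMatrix_lower :
    (normMatrix U - ((1 - ε) * (size U / n)) • (1 : Matrix (Fin n) (Fin n) ℝ)).PosSemidef
  normMatrix_upper :
    (((1 + ε) * (size U / n)) • (1 : Matrix (Fin n) (Fin n) ℝ) - normMatrix U).PosSemidef

/-- Doubly balanced frames are the `0`-nearly doubly balanced ones. -/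
def IsDoublyBalanced {n d : ℕ} (U : Frame n d) : Prop := IsNearlyDoublyBalanced 0 U

/-- The angle `θ(V) = max_{i ≠ j} ⟪v i, v j⟫²`. The index set is finite, so the supremum is a
maximum as soon as there is a pair `i ≠ j`; otherwise the angle is `0`. -/
noncomputable def angle {n d : ℕ} (V : Frame n d) : ℝ :=
  ⨆ p : {p : Fin n × Fin n // p.1 ≠ p.2}, (inner ℝ (V p.1.1) (V p.1.2)) ^ 2

end FrameScaling

namespace FrameScaling

open Finset

/-! An exactly balanced frame is built directly, so no nearly balanced frame has to be corrected.
Take rows of the Hartley matrix of odd order `m`, with entries `cos + sin`, restricted to `d`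
frequencies symmetric under negation. Orthogonality of characters gives tightness, and the symmetry
cancels all sines, so rows have norm 1 and the inner product of two rows is a Fourier coefficient of
the frequency set, divided by `d`. A pseudorandom set makes these coefficients `O(√(d log d))`
(`exists_isFlatTight_of_odd`).

Blocks of this kind are joined to reach every `n ≥ 4d + 2`: flipping signs of the coordinates of one
block keeps it tight, and since all entries are `O(1/√d)`, some signs make every cross inner product
`O(√(log n / d))` (`IsFlatTight.exists_sum`). The resulting angle `O(log n / d)` is within both
claimed bounds; the few remaining cases use copies of an orthonormal basis. -/

/-! ### Derandomized Chernoff bounds -/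

/-- Two-point Hoeffding estimate. -/
theorem two_point_exp_le {p x : ℝ} (hp0 : 0 ≤ p) (hp1 : p ≤ 1) (hx : |x| ≤ 1) :
    p * Real.exp ((1 - p) * x) + (1 - p) * Real.exp (-(p * x)) ≤ Real.exp (x ^ 2) := by
  -- In the mean the linear terms cancel and the quadratic ones add up to `p (1 - p) x ^ 2`.
  have key : ∀ y : ℝ, |y| ≤ 1 → Real.exp y ≤ 1 + y + y ^ 2 := fun y hy => by
    have := (abs_le.1 (Real.abs_exp_sub_one_sub_id_le hy)).2
    linarith
  have h1 : |(1 - p) * x| ≤ 1 := by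
    rw [abs_mul, abs_of_nonneg (by linarith)]
    exact mul_le_one₀ (by linarith) (abs_nonneg _) hx
  have h2 : |-(p * x)| ≤ 1 := by
    rw [abs_neg, abs_mul, abs_of_nonneg hp0]
    exact mul_le_one₀ hp1 (abs_nonneg _) hx
  have e1 := mul_le_mul_of_nonneg_left (key _ h1) hp0
  have e2 := mul_le_mul_of_nonneg_left (key _ h2) (sub_nonneg.2 hp1)
  have e3 := Real.add_one_le_exp (x ^ 2)
  have e4 : p * (1 - p) * x ^ 2 ≤ x ^ 2 := by
    have : p * (1 - p) ≤ 1 := by nlinarith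
    exact mul_le_of_le_one_left (sq_nonneg x) this
  nlinarith

/-- Method of conditional expectations: if each new element is kept with probability `p`, the
expected potential grows by a factor at most `exp (l ^ 2)`, so one of the two choices does no worse.
-/
theorem exists_subset_potential_le {ι κ : Type*} [DecidableEq ι] (H : Finset ι) (K : Finset κ)
    (f : κ → ι → ℝ) (hf : ∀ k i, |f k i| ≤ 1) {p l : ℝ} (hp0 : 0 ≤ p) (hp1 : p ≤ 1)
    (hl : |l| ≤ 1) :
    ∃ T ⊆ H, ∑ k ∈ K, (Real.exp (l * (∑ i ∈ T, f k i - p * ∑ i ∈ H, f k i))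
        + Real.exp (-l * (∑ i ∈ T, f k i - p * ∑ i ∈ H, f k i)))
      ≤ 2 * #K * Real.exp (l ^ 2 * #H) := by
  induction H using Finset.induction_on with
  | empty =>
    refine ⟨∅, le_rfl, ?_⟩
    simp only [sum_empty, mul_zero, sub_zero, Real.exp_zero, sum_const, nsmul_eq_mul, card_empty,
      Nat.cast_zero]
    linarith
  | insert a H ha ih =>
    obtain ⟨T, hT, hb⟩ := ih
    have haT : a ∉ T := fun h => ha (hT h)
    set D : κ → ℝ := fun k => ∑ i ∈ T, f k i - p * ∑ i ∈ H, f k i with hD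
    -- `A` is the potential when `a` is kept, `B` when it is dropped.
    set A : ℝ := ∑ k ∈ K, (Real.exp (l * (D k + (1 - p) * f k a))
      + Real.exp (-l * (D k + (1 - p) * f k a))) with hA
    set B : ℝ := ∑ k ∈ K, (Real.exp (l * (D k - p * f k a))
      + Real.exp (-l * (D k - p * f k a))) with hB
    have one : ∀ k, ∀ μ : ℝ, |μ| ≤ 1 → p * Real.exp (μ * (D k + (1 - p) * f k a))
        + (1 - p) * Real.exp (μ * (D k - p * f k a)) ≤ Real.exp (μ ^ 2) * Real.exp (μ * D k) := by
      intro k μ hμ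
      have hx : |μ * f k a| ≤ 1 := by
        rw [abs_mul]; exact mul_le_one₀ hμ (abs_nonneg _) (hf k a)
      have h1 := two_point_exp_le hp0 hp1 hx
      have h2 : Real.exp ((μ * f k a) ^ 2) ≤ Real.exp (μ ^ 2) := by
        apply Real.exp_le_exp.2
        rw [mul_pow]
        exact mul_le_of_le_one_right (sq_nonneg _) ((sq_le_one_iff_abs_le_one _).2 (hf k a))
      have e1 : μ * (D k + (1 - p) * f k a) = μ * D k + (1 - p) * (μ * f k a) := by ring
      have e2 : μ * (D k - p * f k a) = μ * D k + -(p * (μ * f k a)) := by ring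
      rw [e1, e2, Real.exp_add, Real.exp_add]
      have := mul_le_mul_of_nonneg_right (h1.trans h2) (Real.exp_pos (μ * D k)).le
      linarith
    have avg : p * A + (1 - p) * B ≤ 2 * #K * Real.exp (l ^ 2 * #(insert a H)) := by
      have h1 : p * A + (1 - p) * B ≤ Real.exp (l ^ 2) *
          ∑ k ∈ K, (Real.exp (l * D k) + Real.exp (-l * D k)) := by
        rw [hA, hB, mul_sum, mul_sum, mul_sum, ← sum_add_distrib]
        refine sum_le_sum fun k _ => ?_
        have a1 := one k l hl
        have a2 := one k (-l) (by rwa [abs_neg])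
        rw [neg_sq] at a2
        linarith
      refine h1.trans ((mul_le_mul_of_nonneg_left hb (Real.exp_pos _).le).trans (le_of_eq ?_))
      rw [card_insert_of_notMem ha, Nat.cast_add_one, mul_add, mul_one, Real.exp_add]
      ring
    rcases le_total A B with h | h
    · refine ⟨insert a T, insert_subset_insert a hT, le_trans (b := A) (le_of_eq ?_) (le_trans ?_ avg)⟩
      · refine sum_congr rfl fun k _ => ?_
        rw [sum_insert haT, sum_insert ha]
        congr 2 <;> simp only [hD] <;> ring
      · nlinarith
    · refine ⟨T, hT.trans (subset_insert a H), le_trans (b := B) (le_of_eq ?_) (le_trans ?_ avg)⟩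
      · refine sum_congr rfl fun k _ => ?_
        rw [sum_insert ha]
        congr 2 <;> simp only [hD] <;> ring
      · nlinarith

/-- A `p`-random subset approximates all the functions of a finite family simultaneously. -/
theorem exists_subset_discrepancy_le {ι κ : Type*} [DecidableEq ι] (H : Finset ι) (K : Finset κ)
    (f : κ → ι → ℝ) (hf : ∀ k i, |f k i| ≤ 1) {p : ℝ} (hp0 : 0 ≤ p) (hp1 : p ≤ 1) :
    ∃ T ⊆ H, ∀ k ∈ K, |∑ i ∈ T, f k i - p * ∑ i ∈ H, f k i|
      ≤ 2 * √(#H * Real.log (2 * #K)) := by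
  rcases K.eq_empty_or_nonempty with rfl | hK
  · exact ⟨∅, empty_subset _, by simp⟩
  have hK1 : (1 : ℝ) ≤ #K := by exact_mod_cast hK.card_pos
  have hL : 0 < Real.log (2 * #K) := Real.log_pos (by linarith)
  set L := Real.log (2 * #K) with hLdef
  rcases le_or_gt (#H : ℝ) L with hh | hh
  · refine ⟨∅, empty_subset _, fun k _ => ?_⟩
    have h1 : |∑ i ∈ H, f k i| ≤ #H :=
      (abs_sum_le_sum_abs _ _).trans ((sum_le_sum fun i _ => hf k i).trans (by simp))
    have h2 : (#H : ℝ) ≤ √(#H * L) := Real.le_sqrt_of_sq_le (by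
      rw [sq]; exact mul_le_mul_of_nonneg_left hh (Nat.cast_nonneg _))
    rw [sum_empty, zero_sub, abs_neg, abs_mul, abs_of_nonneg hp0]
    have h3 : p * |∑ i ∈ H, f k i| ≤ 1 * #H := by gcongr
    have h4 := Real.sqrt_nonneg (#H * L)
    linarith
  · have hH : (0 : ℝ) < #H := hL.trans hh
    -- This choice gives `l ^ 2 * #H = L`; it needs `L ≤ #H` for `l ≤ 1`, and otherwise the trivial
    -- bound has sufficed.
    set l := √(L / #H) with hl
    have hl0 : 0 < l := Real.sqrt_pos.2 (div_pos hL hH)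
    have hlsq : l ^ 2 * #H = L := by
      rw [hl, Real.sq_sqrt (div_pos hL hH).le, div_mul_cancel₀ _ hH.ne']
    have hl1 : |l| ≤ 1 := by
      rw [abs_of_pos hl0, hl]
      exact Real.sqrt_le_one.2 ((div_le_one hH).2 hh.le)
    obtain ⟨T, hT, hb⟩ := exists_subset_potential_le H K f hf hp0 hp1 hl1
    refine ⟨T, hT, fun k hk => ?_⟩
    set D := ∑ i ∈ T, f k i - p * ∑ i ∈ H, f k i with hD
    have hs : Real.exp (l * D) + Real.exp (-l * D) ≤ Real.exp (2 * L) := by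
      have := (single_le_sum (f := fun k => Real.exp (l * (∑ i ∈ T, f k i - p * ∑ i ∈ H, f k i))
        + Real.exp (-l * (∑ i ∈ T, f k i - p * ∑ i ∈ H, f k i)))
        (fun k _ => by positivity) hk).trans hb
      refine this.trans (le_of_eq ?_)
      rw [hlsq, two_mul L, Real.exp_add, hLdef, Real.exp_log (by linarith)]
    have h1 : l * D ≤ 2 * L := Real.exp_le_exp.1 (by linarith [Real.exp_pos (-l * D)])
    have h2 : -l * D ≤ 2 * L := Real.exp_le_exp.1 (by linarith [Real.exp_pos (l * D)])
    have h3 : l * |D| ≤ 2 * L := by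
      rcases abs_cases D with ⟨h, _⟩ | ⟨h, _⟩ <;> rw [h] <;> linarith
    have h4 : l * √(#H * L) = L := by
      rw [hl, ← Real.sqrt_mul (div_pos hL hH).le,
        show L / #H * (#H * L) = L ^ 2 by field_simp, Real.sqrt_sq hL.le]
    refine le_of_mul_le_mul_left ?_ hl0
    linarith

/-- A version of `exists_subset_discrepancy_le` for signs. -/
theorem exists_sign_sum_le {ι κ : Type*} [Fintype ι] [Fintype κ] (f : κ → ι → ℝ)
    (hf : ∀ k i, |f k i| ≤ 1) :
    ∃ ε : ι → ℝ, (∀ i, ε i = 1 ∨ ε i = -1) ∧ ∀ k, |∑ i, ε i * f k i|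
      ≤ 4 * √(Fintype.card ι * Real.log (2 * Fintype.card κ)) := by
  classical
  obtain ⟨T, -, hT⟩ := exists_subset_discrepancy_le univ univ f hf (p := 1 / 2)
    (by norm_num) (by norm_num)
  refine ⟨fun i => if i ∈ T then 1 else -1, fun i => by by_cases h : i ∈ T <;> simp [h],
    fun k => ?_⟩
  have h := hT k (mem_univ k)
  have e : ∑ i, (if i ∈ T then (1 : ℝ) else -1) * f k i
      = 2 * (∑ i ∈ T, f k i - 1 / 2 * ∑ i, f k i) := by
    have h1 : ∑ i ∈ T, f k i = ∑ i, if i ∈ T then f k i else 0 := by simp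
    rw [h1, mul_sub, mul_sum, ← mul_assoc, mul_sum, ← sum_sub_distrib]
    refine sum_congr rfl fun i _ => ?_
    split_ifs <;> ring
  rw [e, abs_mul, abs_two]
  rw [card_univ, card_univ] at h
  linarith

/-- A subset can be given a prescribed cardinality at a cost bounded by the discrepancy. -/
theorem exists_subset_card_eq_sum_close {ι κ : Type*} [DecidableEq ι] {H T₀ : Finset ι}
    (hT₀ : T₀ ⊆ H) {t : ℕ} (ht : t ≤ #H) (f : κ → ι → ℝ) (hf : ∀ k i, |f k i| ≤ 1) :
    ∃ T ⊆ H, #T = t ∧ ∀ k, |∑ i ∈ T, f k i - ∑ i ∈ T₀, f k i| ≤ |(#T₀ : ℝ) - t| := by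
  have bound : ∀ A : Finset ι, ∀ k, |∑ i ∈ A, f k i| ≤ #A := fun A k =>
    (abs_sum_le_sum_abs _ _).trans ((sum_le_sum fun i _ => hf k i).trans (by simp))
  rcases le_total t #T₀ with h | h
  · obtain ⟨T, hT, hc⟩ := exists_subset_card_eq h
    refine ⟨T, hT.trans hT₀, hc, fun k => ?_⟩
    have e := sum_sdiff (f := f k) hT
    have c : (#(T₀ \ T) : ℝ) = #T₀ - t := by
      rw [card_sdiff_of_subset hT, hc, Nat.cast_sub h]
    have b := bound (T₀ \ T) k
    rw [c] at b
    rw [abs_sub_comm, ← e, add_sub_cancel_right]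
    exact b.trans (le_abs_self _)
  · obtain ⟨T, h1, h2, hc⟩ := exists_subsuperset_card_eq hT₀ h ht
    refine ⟨T, h2, hc, fun k => ?_⟩
    have e := sum_sdiff (f := f k) h1
    have c : (#(T \ T₀) : ℝ) = t - #T₀ := by
      rw [card_sdiff_of_subset h1, hc, Nat.cast_sub h]
    have b := bound (T \ T₀) k
    rw [c] at b
    rw [← e, add_sub_cancel_right, abs_sub_comm (#T₀ : ℝ)]
    exact b.trans (le_abs_self _)

/-! ### Trigonometric sums modulo `m` -/

theorem exp_two_pi_I_mul_div_eq (m : ℕ) (k : ℤ) (i : ℕ) :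
    Complex.exp (2 * Real.pi * Complex.I * (k / m)) ^ i
      = Real.cos (2 * Real.pi * i * k / m) + Real.sin (2 * Real.pi * i * k / m) * Complex.I := by
  rw [← Complex.exp_nat_mul, Complex.ofReal_cos, Complex.ofReal_sin, ← Complex.exp_mul_I]
  congr 1
  push_cast
  ring

/-- Orthogonality of the characters of `ℤ/m`. -/
theorem sum_exp_pow_eq_zero {m : ℕ} (hm : m ≠ 0) {k : ℤ} (hk : ¬ (m : ℤ) ∣ k) :
    ∑ i ∈ range m, Complex.exp (2 * Real.pi * Complex.I * (k / m)) ^ i = 0 := by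
  have hmC : (m : ℂ) ≠ 0 := by exact_mod_cast hm
  set z := Complex.exp (2 * Real.pi * Complex.I * (k / m)) with hz
  have h1 : z ≠ 1 := by
    intro h
    rw [hz, Complex.exp_eq_one_iff] at h
    obtain ⟨n, hn⟩ := h
    have h2 : (k : ℂ) / m = n := by
      have h3 := Complex.two_pi_I_ne_zero
      refine mul_left_cancel₀ h3 ?_
      rw [hn]; ring
    rw [div_eq_iff hmC] at h2
    refine hk ⟨n, ?_⟩
    have : k = n * m := by exact_mod_cast h2
    rw [this, mul_comm]
  have h2 : z ^ m = 1 := by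
    rw [hz, ← Complex.exp_nat_mul, Complex.exp_eq_one_iff]
    exact ⟨k, by field_simp⟩
  rw [geom_sum_eq h1, h2, sub_self, zero_div]

theorem sum_cos_eq_zero {m : ℕ} (hm : m ≠ 0) {k : ℤ} (hk : ¬ (m : ℤ) ∣ k) :
    ∑ i ∈ range m, Real.cos (2 * Real.pi * i * k / m) = 0 := by
  have h := congrArg Complex.re (sum_exp_pow_eq_zero hm hk)
  simp_rw [exp_two_pi_I_mul_div_eq] at h
  simpa [-Complex.ofReal_cos, -Complex.ofReal_sin] using h

theorem sum_sin_eq_zero {m : ℕ} (hm : m ≠ 0) (k : ℤ) :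
    ∑ i ∈ range m, Real.sin (2 * Real.pi * i * k / m) = 0 := by
  by_cases hk : (m : ℤ) ∣ k
  · obtain ⟨l, rfl⟩ := hk
    refine sum_eq_zero fun i _ => ?_
    have hmR : (m : ℝ) ≠ 0 := by exact_mod_cast hm
    rw [Real.sin_eq_zero_iff]
    refine ⟨2 * i * l, ?_⟩
    push_cast
    field_simp
  · have h := congrArg Complex.im (sum_exp_pow_eq_zero hm hk)
    simp_rw [exp_two_pi_I_mul_div_eq] at h
    simpa [-Complex.ofReal_cos, -Complex.ofReal_sin] using h

/-- The Dirichlet kernel, by telescoping. -/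
theorem two_mul_sin_mul_sum_cos (x : ℝ) (h : ℕ) :
    2 * Real.sin (x / 2) * ∑ s ∈ range h, Real.cos ((s + 1) * x)
      = Real.sin ((h + 1 / 2) * x) - Real.sin (x / 2) := by
  induction h with
  | zero => simp [div_eq_inv_mul]
  | succ h ih =>
    rw [sum_range_succ, mul_add, ih]
    have e1 : ((h : ℝ) + 1 / 2) * x = (h + 1) * x - x / 2 := by ring
    have e2 : (((h + 1 : ℕ) : ℝ) + 1 / 2) * x = (h + 1) * x + x / 2 := by push_cast; ring
    rw [e1, e2, Real.sin_add, Real.sin_sub]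
    ring

theorem sum_cos_half {h : ℕ} {k : ℤ} (hk : ¬ ((2 * h + 1 : ℕ) : ℤ) ∣ k) :
    ∑ s ∈ range h, Real.cos (2 * Real.pi * k * (s + 1) / (2 * h + 1 : ℕ)) = -1 / 2 := by
  have hm : ((2 * h + 1 : ℕ) : ℝ) ≠ 0 := by positivity
  set x : ℝ := 2 * Real.pi * k / (2 * h + 1 : ℕ) with hx
  have h1 := two_mul_sin_mul_sum_cos x h
  have h2 : Real.sin ((h + 1 / 2) * x) = 0 := by
    rw [Real.sin_eq_zero_iff]
    refine ⟨k, ?_⟩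
    rw [hx]
    push_cast at hm ⊢
    field_simp
  have h3 : Real.sin (x / 2) ≠ 0 := by
    rw [Ne, Real.sin_eq_zero_iff]
    rintro ⟨n, hn⟩
    refine hk ⟨n, ?_⟩
    rw [hx] at hn
    field_simp at hn
    have : (n : ℝ) * ((2 * h + 1 : ℕ) : ℝ) = k := by
      linarith
    have h4 : n * ((2 * h + 1 : ℕ) : ℤ) = k := by exact_mod_cast this
    rw [← h4, mul_comm]
  have e : ∑ s ∈ range h, Real.cos (2 * Real.pi * k * (s + 1) / (2 * h + 1 : ℕ))
      = ∑ s ∈ range h, Real.cos ((s + 1) * x) := by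
    refine sum_congr rfl fun s _ => ?_
    congr 1
    rw [hx]; ring
  rw [e]
  refine mul_left_cancel₀ (mul_ne_zero two_ne_zero h3) ?_
  rw [h1, h2]; ring

/-! ### Pseudorandom symmetric frequencies -/

/-- A set of `t` frequencies with small Fourier coefficients. -/
theorem exists_frequencies {h t : ℕ} (ht : t ≤ h) :
    ∃ T ⊆ range h, #T = t ∧ ∀ k : ℤ, |k| < (2 * h + 1 : ℕ) → k ≠ 0 →
      |∑ s ∈ T, Real.cos (2 * Real.pi * k * (s + 1) / (2 * h + 1 : ℕ))|
        ≤ 1 / 2 + 4 * √(h * Real.log (2 * (2 * h + 1 : ℕ))) := by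
  rcases Nat.eq_zero_or_pos h with rfl | hpos
  · refine ⟨∅, empty_subset _, by simp; omega, fun k _ _ => by simp⟩
  set m := 2 * h + 1 with hm
  have hhR : (0 : ℝ) < h := by exact_mod_cast hpos
  set f : ℕ → ℕ → ℝ := fun k s => Real.cos (2 * Real.pi * k * (s + 1) / m) with hf
  have hf1 : ∀ k s, |f k s| ≤ 1 := fun k s => Real.abs_cos_le_one _
  have hp1 : (t : ℝ) / h ≤ 1 := (div_le_one hhR).2 (by exact_mod_cast ht)
  have hp0 : (0 : ℝ) ≤ t / h := by positivity
  obtain ⟨T₀, hT₀, hdisc⟩ := exists_subset_discrepancy_le (range h) (range m) f hf1 hp0 hp1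
  rw [card_range, card_range] at hdisc
  obtain ⟨T, hT, hc, hclose⟩ :=
    exists_subset_card_eq_sum_close hT₀ (by rwa [card_range] : t ≤ #(range h)) f hf1
  -- At frequency 0 the discrepancy is that of the cardinality, so adjusting `T₀` to size `t` costs
  -- no more than a second discrepancy term.
  have h0 := hdisc 0 (mem_range.2 (by omega))
  have hf0 : ∀ s, f 0 s = 1 := fun s => by simp [hf]
  simp only [hf0, sum_const, card_range, nsmul_eq_mul, mul_one] at h0
  rw [div_mul_cancel₀ _ hhR.ne'] at h0
  refine ⟨T, hT, hc, fun k hk hk0 => ?_⟩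
  have hkm : k.natAbs < m := by
    rw [Int.abs_eq_natAbs] at hk; exact_mod_cast hk
  have e : ∀ s : ℕ, Real.cos (2 * Real.pi * k * (s + 1) / m) = f k.natAbs s := by
    intro s
    simp only [hf]
    obtain ⟨n, rfl | rfl⟩ := Int.eq_nat_or_neg k
    · simp
    · rw [← Real.cos_neg, Int.natAbs_neg, Int.natAbs_natCast]
      congr 1
      push_cast
      ring
  simp_rw [e]
  have h1 := hdisc k.natAbs (mem_range.2 hkm)
  have h2 : ∑ s ∈ range h, f k.natAbs s = -1 / 2 := by
    simp_rw [← e]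
    refine sum_cos_half fun hd => ?_
    have := Int.le_of_dvd (abs_pos.2 hk0) ((dvd_abs _ _).2 hd)
    omega
  rw [h2] at h1
  have h3 := (hclose k.natAbs).trans h0
  rw [abs_le] at h1 h3 ⊢
  constructor <;> nlinarith

/-- The symmetrization of a set of positive frequencies, with a zero frequency added for odd
cardinality. -/
theorem exists_symmetric_frequencies {h d : ℕ} {T : Finset ℕ} (hT : T ⊆ range h)
    (hc : #T = d / 2) :
    ∃ S : Finset ℤ, #S = d ∧ (∀ s ∈ S, |s| ≤ h) ∧ ∀ F : ℤ → ℝ,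
      ∑ s ∈ S, F s = (d % 2 : ℕ) * F 0 + ∑ s ∈ T, (F (s + 1) + F (-(s + 1))) := by
  set P : Finset ℤ := T.image fun s : ℕ => (s : ℤ) + 1
  set N : Finset ℤ := T.image fun s : ℕ => -((s : ℤ) + 1)
  set Z : Finset ℤ := if d % 2 = 1 then {0} else ∅ with hZ
  have iP : Function.Injective fun s : ℕ => (s : ℤ) + 1 := fun a b h => by
    simp only at h; omega
  have iN : Function.Injective fun s : ℕ => -((s : ℤ) + 1) := fun a b h => by
    simp only at h; omega
  have mZ : ∀ x ∈ Z, x = 0 := fun x hx => by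
    rw [hZ] at hx; split_ifs at hx <;> simp_all
  have d1 : Disjoint P N := by
    rw [disjoint_left]
    intro x hx hy
    obtain ⟨a, -, rfl⟩ := mem_image.1 hx
    obtain ⟨b, -, hb⟩ := mem_image.1 hy
    omega
  have d2 : Disjoint Z (P ∪ N) := by
    rw [disjoint_left]
    intro x hx hy
    have := mZ x hx
    subst this
    rcases mem_union.1 hy with hy | hy <;> obtain ⟨b, -, hb⟩ := mem_image.1 hy <;> omega
  have cZ : #Z = d % 2 := by
    rw [hZ]; split_ifs with h
    · simp [h]
    · rw [card_empty]; omega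
  refine ⟨Z ∪ (P ∪ N), ?_, ?_, fun F => ?_⟩
  · rw [card_union_of_disjoint d2, card_union_of_disjoint d1, card_image_of_injective _ iP,
      card_image_of_injective _ iN, hc, cZ]
    omega
  · intro s hs
    rcases mem_union.1 hs with hs | hs
    · rw [mZ s hs]; simp
    · rcases mem_union.1 hs with hs | hs <;> obtain ⟨b, hb, rfl⟩ := mem_image.1 hs <;>
        have := mem_range.1 (hT hb) <;> rw [abs_le] <;> constructor <;> omega
  · rw [sum_union d2, sum_union d1, sum_image iP.injOn, sum_image iN.injOn, sum_add_distrib]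
    congr 1
    rw [sum_eq_card_nsmul (b := F 0) fun x hx => by rw [mZ x hx], cZ, nsmul_eq_mul]

/-- Symmetric frequencies, enumerated by `Fin d`, with small Fourier coefficients. -/
theorem exists_enumerated_frequencies {h d : ℕ} (hd : d / 2 ≤ h) :
    ∃ e : Fin d → ℤ, Function.Injective e ∧ (∀ j, |e j| ≤ h) ∧
      (∀ x : ℝ, ∑ j, Real.sin (x * e j) = 0) ∧
      ∀ k : ℤ, |k| < (2 * h + 1 : ℕ) → k ≠ 0 →
        |∑ j, Real.cos (2 * Real.pi * k / (2 * h + 1 : ℕ) * e j)|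
          ≤ 2 + 8 * √(h * Real.log (2 * (2 * h + 1 : ℕ))) := by
  obtain ⟨T, hT, hc, hb⟩ := exists_frequencies hd
  obtain ⟨S, hS, hSh, hF⟩ := exists_symmetric_frequencies hT hc
  set φ := (S.equivFinOfCardEq hS).symm
  have key : ∀ F : ℤ → ℝ, ∑ j, F (φ j) = ∑ s ∈ S, F s := fun F => by
    rw [φ.sum_comp (fun s : S => F s), sum_coe_sort S F]
  refine ⟨fun j => φ j, fun a b h => φ.injective (Subtype.ext h), fun j => hSh _ (φ j).2,
    fun x => ?_, fun k hk hk0 => ?_⟩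
  · rw [key fun s => Real.sin (x * s), hF]
    simp only [Int.cast_zero, mul_zero, Real.sin_zero, zero_add]
    refine sum_eq_zero fun s _ => ?_
    rw [Int.cast_neg, mul_neg, Real.sin_neg, add_neg_cancel]
  · rw [key fun s => Real.cos (2 * Real.pi * k / (2 * h + 1 : ℕ) * s), hF]
    have h1 := hb k hk hk0
    have h2 : ∑ s ∈ T, (Real.cos (2 * Real.pi * k / (2 * h + 1 : ℕ) * ((s : ℤ) + 1 : ℤ))
        + Real.cos (2 * Real.pi * k / (2 * h + 1 : ℕ) * (-((s : ℤ) + 1) : ℤ)))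
        = 2 * ∑ s ∈ T, Real.cos (2 * Real.pi * k * (s + 1) / (2 * h + 1 : ℕ)) := by
      rw [mul_sum]
      refine sum_congr rfl fun s _ => ?_
      rw [Int.cast_neg, mul_neg, Real.cos_neg, ← two_mul]
      congr 2
      push_cast
      ring
    rw [h2]
    simp only [Int.cast_zero, mul_zero, Real.cos_zero, mul_one]
    have h3 : ((d % 2 : ℕ) : ℝ) ≤ 1 := by
      exact_mod_cast (by omega : d % 2 ≤ 1)
    have h4 : (0 : ℝ) ≤ (d % 2 : ℕ) := Nat.cast_nonneg _
    rw [abs_le] at h1 ⊢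
    constructor <;> linarith

/-! ### Flat tight frames: Hartley blocks and their unions -/

/-- Unit norm tight frames in coordinates, with flat coordinates and squared coherence at
most `B`. -/
structure IsFlatTight {ι : Type*} [Fintype ι] {d : ℕ} (B : ℝ) (V : ι → Fin d → ℝ) : Prop where
  tight : ∀ j j', ∑ i, V i j * V i j' = if j = j' then (Fintype.card ι : ℝ) / d else 0
  unit : ∀ i, ∑ j, V i j ^ 2 = 1
  flat : ∀ i j, V i j ^ 2 ≤ 2 / d
  coherence : ∀ i i', i ≠ i' → (∑ j, V i j * V i' j) ^ 2 ≤ B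

theorem cos_add_sin_mul_cos_add_sin (a b : ℝ) :
    (Real.cos a + Real.sin a) * (Real.cos b + Real.sin b)
      = Real.cos (a - b) + Real.sin (a + b) := by
  rw [Real.cos_sub, Real.sin_add]; ring

/-- Hartley frames: rows of the `m × m` Hartley matrix at pseudorandom symmetric frequencies. -/
theorem exists_isFlatTight_of_odd {d h : ℕ} (hd : 2 ≤ d) (h1 : d ≤ h) (h2 : h < 4 * d) :
    ∃ V : Fin (2 * h + 1) → Fin d → ℝ, IsFlatTight (324 * Real.log (16 * d) / d) V := by
  obtain ⟨e, einj, ele, esin, ecos⟩ := exists_enumerated_frequencies (h := h) (d := d) (by omega)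
  set m := 2 * h + 1 with hm
  have hm0 : m ≠ 0 := by omega
  have hmR : (m : ℝ) ≠ 0 := by exact_mod_cast hm0
  have hd0 : (0 : ℝ) < d := by exact_mod_cast (by omega : 0 < d)
  have hsq : √(d : ℝ) * √(d : ℝ) = d := Real.mul_self_sqrt hd0.le
  have hs0 : √(d : ℝ) ≠ 0 := (Real.sqrt_pos.2 hd0).ne'
  set θ : Fin m → Fin d → ℝ := fun i j => 2 * Real.pi * i * e j / m with hθ
  have prod : ∀ i j i' j', (Real.cos (θ i j) + Real.sin (θ i j)) / √(d : ℝ)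
      * ((Real.cos (θ i' j') + Real.sin (θ i' j')) / √(d : ℝ))
      = (Real.cos (θ i j - θ i' j') + Real.sin (θ i j + θ i' j')) / d := by
    intro i j i' j'
    rw [div_mul_div_comm, hsq, cos_add_sin_mul_cos_add_sin]
  have inner_eq : ∀ i i', ∑ j, (Real.cos (θ i j) + Real.sin (θ i j)) / √(d : ℝ)
      * ((Real.cos (θ i' j) + Real.sin (θ i' j)) / √(d : ℝ))
      = (∑ j, Real.cos (2 * Real.pi * (((i : ℕ) : ℤ) - ((i' : ℕ) : ℤ) : ℤ) / m * e j)) / d := by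
    intro i i'
    simp_rw [prod]
    rw [← sum_div, sum_add_distrib]
    -- The frequencies are symmetric under negation and sine is odd.
    have s0 : ∑ j, Real.sin (θ i j + θ i' j) = 0 := by
      rw [← esin (2 * Real.pi * (i + i') / m)]
      refine sum_congr rfl fun j _ => ?_
      congr 1
      simp only [hθ]; ring
    rw [s0, add_zero]
    congr 1
    refine sum_congr rfl fun j _ => ?_
    congr 1
    simp only [hθ]; push_cast; ring
  refine ⟨fun i j => (Real.cos (θ i j) + Real.sin (θ i j)) / √(d : ℝ), ?_, ?_, ?_, ?_⟩
  · intro j j'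
    simp_rw [prod]
    rw [← sum_div, sum_add_distrib]
    have s0 : ∑ i : Fin m, Real.sin (θ i j + θ i j') = 0 := by
      rw [← sum_sin_eq_zero hm0 (e j + e j'),
        ← Fin.sum_univ_eq_sum_range fun i => Real.sin (2 * Real.pi * i * (e j + e j' : ℤ) / m)]
      refine sum_congr rfl fun i _ => ?_
      congr 1
      simp only [hθ]; push_cast; ring
    rw [s0, add_zero]
    split_ifs with hj
    · subst hj
      simp
    · have s1 : ∑ i : Fin m, Real.cos (θ i j - θ i j') = 0 := by
        -- Frequencies lie in `[-h, h]`, so distinct ones differ by at most `2 * h < m`.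
        have hk : ¬ (m : ℤ) ∣ (e j - e j') := by
          intro hdvd
          have hne : e j - e j' ≠ 0 := sub_ne_zero.2 fun h => hj (einj h)
          have := Int.le_of_dvd (abs_pos.2 hne) ((dvd_abs _ _).2 hdvd)
          have a1 := ele j
          have a2 := ele j'
          have a3 := abs_sub (e j) (e j')
          omega
        rw [← sum_cos_eq_zero hm0 hk,
          ← Fin.sum_univ_eq_sum_range fun i => Real.cos (2 * Real.pi * i * (e j - e j' : ℤ) / m)]
        refine sum_congr rfl fun i _ => ?_
        congr 1
        simp only [hθ]; push_cast; ring
      rw [s1, zero_div]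
  · intro i
    simp_rw [sq]
    rw [inner_eq]
    simp [hd0.ne']
  · intro i j
    rw [sq, prod]
    refine div_le_div_of_nonneg_right ?_ hd0.le
    rw [sub_self, Real.cos_zero]
    linarith [Real.sin_le_one (θ i j + θ i j)]
  · intro i i' hii
    rw [inner_eq]
    set k : ℤ := ((i : ℕ) : ℤ) - ((i' : ℕ) : ℤ) with hk
    have hk0 : k ≠ 0 := by
      have : (i : ℕ) ≠ i' := fun h => hii (Fin.ext h)
      omega
    have hkm : |k| < (m : ℕ) := by
      rw [abs_lt]; constructor <;> omega
    have hb := ecos k hkm hk0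
    set L := Real.log (16 * d) with hL
    have hd2 : (2 : ℝ) ≤ d := by exact_mod_cast hd
    have hL1 : 1 ≤ L := by
      rw [hL, Real.le_log_iff_exp_le (by linarith)]
      linarith [Real.exp_one_lt_d9]
    have hlog : Real.log (2 * m) ≤ L := by
      refine Real.log_le_log (by positivity) ?_
      have : m ≤ 8 * d := by omega
      have : (m : ℝ) ≤ 8 * d := by exact_mod_cast this
      linarith
    have hh : (h : ℝ) ≤ 4 * d := by exact_mod_cast h2.le
    have hlog0 : 0 ≤ Real.log (2 * m) := by
      refine Real.log_nonneg ?_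
      have : (1 : ℝ) ≤ m := by exact_mod_cast (by omega : 1 ≤ m)
      linarith
    have hr : √(h * Real.log (2 * m)) ≤ 2 * √(d * L) := by
      rw [show (2 : ℝ) = √(2 ^ 2) by rw [Real.sqrt_sq]; norm_num, ← Real.sqrt_mul (by norm_num)]
      refine Real.sqrt_le_sqrt ?_
      rw [show (√(2 ^ 2) : ℝ) = 2 by rw [Real.sqrt_sq]; norm_num]
      calc (h : ℝ) * Real.log (2 * m) ≤ (4 * d) * L := by gcongr
        _ = 2 ^ 2 * (d * L) := by ring
    have hr1 : 1 ≤ √(d * L) := Real.one_le_sqrt.2 (by nlinarith)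
    -- `2 + 8 * 2 = 18`, whose square is the constant 324.
    have hb2 := hb.trans (by linarith : _ ≤ 18 * √(d * L))
    have hb3 := sq_le_sq' (neg_le_of_abs_le hb2) (le_of_abs_le hb2)
    rw [mul_pow, Real.sq_sqrt (by positivity)] at hb3
    rw [div_pow, div_le_div_iff₀ (by positivity) hd0]
    nlinarith

theorem IsFlatTight.reindex {ι κ : Type*} [Fintype ι] [Fintype κ] {d : ℕ} {B : ℝ}
    {V : ι → Fin d → ℝ} (hV : IsFlatTight B V) (φ : κ ≃ ι) :
    IsFlatTight B (fun k => V (φ k)) where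
  tight j j' := by
    rw [φ.sum_comp fun i => V i j * V i j', hV.tight, Fintype.card_congr φ]
  unit k := hV.unit _
  flat k j := hV.flat _ j
  coherence k k' h := hV.coherence _ _ (φ.injective.ne h)

theorem IsFlatTight.mono {ι : Type*} [Fintype ι] {d : ℕ} {B B' : ℝ}
    {V : ι → Fin d → ℝ} (hV : IsFlatTight B V) (h : B ≤ B') : IsFlatTight B' V where
  __ := hV
  coherence i i' hi := (hV.coherence i i' hi).trans h

/-- Two flat tight frames can be joined after a change of signs of the coordinates of the
second one. -/
theorem IsFlatTight.exists_sum {ι κ : Type*} [Fintype ι] [Fintype κ] {d : ℕ} {B : ℝ}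
    {V : ι → Fin d → ℝ} {W : κ → Fin d → ℝ} (hd : 0 < d) (hV : IsFlatTight B V)
    (hW : IsFlatTight B W)
    (hB : 64 * Real.log (2 * (Fintype.card ι * Fintype.card κ : ℕ)) / d ≤ B) :
    ∃ U : ι ⊕ κ → Fin d → ℝ, IsFlatTight B U := by
  have hd0 : (0 : ℝ) < d := by exact_mod_cast hd
  -- Flatness makes the factor `d / 2` normalize the products to `[-1, 1]`; undoing it gives `(2 *
  -- 4) ^ 2 = 64`.
  set f : ι × κ → Fin d → ℝ := fun p j => d / 2 * (V p.1 j * W p.2 j) with hf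
  have hf1 : ∀ p j, |f p j| ≤ 1 := by
    intro p j
    have h1 := hV.flat p.1 j
    have h2 := hW.flat p.2 j
    have h3 : |V p.1 j * W p.2 j| ≤ 2 / d := by
      rw [abs_le]
      constructor <;> nlinarith [sq_nonneg (V p.1 j - W p.2 j), sq_nonneg (V p.1 j + W p.2 j)]
    rw [hf, abs_mul, abs_of_pos (by positivity : (0 : ℝ) < d / 2)]
    calc (d : ℝ) / 2 * |V p.1 j * W p.2 j| ≤ d / 2 * (2 / d) := by gcongr
      _ = 1 := by field_simp
  obtain ⟨ε, hε, hsum⟩ := exists_sign_sum_le f hf1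
  have hε2 : ∀ j, ε j * ε j = 1 := fun j => by rcases hε j with h | h <;> rw [h] <;> norm_num
  have cross : ∀ i k, (∑ j, V i j * (ε j * W k j)) ^ 2 ≤ B := by
    intro i k
    have h := hsum (i, k)
    rw [Fintype.card_fin, Fintype.card_prod] at h
    set L := Real.log (2 * (Fintype.card ι * Fintype.card κ : ℕ)) with hL
    have hL0 : 0 ≤ L := by
      refine Real.log_nonneg ?_
      have : 0 < Fintype.card ι * Fintype.card κ :=
        Nat.mul_pos (Fintype.card_pos_iff.2 ⟨i⟩) (Fintype.card_pos_iff.2 ⟨k⟩)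
      have : (1 : ℝ) ≤ (Fintype.card ι * Fintype.card κ : ℕ) := by exact_mod_cast this
      linarith
    have e : ∑ j, ε j * f (i, k) j = d / 2 * ∑ j, V i j * (ε j * W k j) := by
      rw [mul_sum]
      refine sum_congr rfl fun j _ => ?_
      simp only [hf]; ring
    rw [e] at h
    have h2 := sq_le_sq' (neg_le_of_abs_le h) (le_of_abs_le h)
    rw [mul_pow, mul_pow, Real.sq_sqrt (by positivity)] at h2
    refine le_trans ?_ hB
    rw [le_div_iff₀ hd0]
    refine le_of_mul_le_mul_left ?_ hd0
    nlinarith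
  refine ⟨Sum.elim V fun k j => ε j * W k j, ?_, ?_, ?_, ?_⟩
  · intro j j'
    rw [Fintype.sum_sum_type]
    simp only [Sum.elim_inl, Sum.elim_inr]
    have e : ∑ k, ε j * W k j * (ε j' * W k j') = ε j * ε j' * ∑ k, W k j * W k j' := by
      rw [mul_sum]
      exact sum_congr rfl fun _ _ => by ring
    rw [e, hV.tight, hW.tight, Fintype.card_sum]
    split_ifs with hj
    · subst hj
      rw [hε2]; push_cast; ring
    · simp
  · rintro (i | k)
    · exact hV.unit i
    · simp only [Sum.elim_inr, mul_pow, sq (ε _), hε2, one_mul]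
      exact hW.unit k
  · rintro (i | k) j
    · exact hV.flat i j
    · simp only [Sum.elim_inr, mul_pow, sq (ε _), hε2, one_mul]
      exact hW.flat k j
  · rintro (i | k) (i' | k') h
    · exact hV.coherence i i' fun e => h (by rw [e])
    · exact cross i k'
    · simp only [Sum.elim_inl, Sum.elim_inr]
      simp_rw [mul_comm _ (V _ _)]
      exact cross i' k
    · simp only [Sum.elim_inr]
      have e : ∀ j, ε j * W k j * (ε j * W k' j) = W k j * W k' j := fun j => by
        linear_combination W k j * W k' j * hε2 j
      simp_rw [e]
      exact hW.coherence k k' fun e => h (by rw [e])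

/-- Blocks of length `2 * d + 1` are split off until a single odd block remains; an even `n` needs
at least two odd blocks, whence `4 * d + 2`. The fixed `N` keeps one coherence bound throughout the
induction. -/
theorem exists_isFlatTight {d N : ℕ} (hd : 2 ≤ d) (hN : 2 * d + 1 ≤ N) (n : ℕ) (hn : n ≤ N)
    (hn' : 2 * d + 1 ≤ n ∧ (n % 2 = 1 ∨ 4 * d + 2 ≤ n)) :
    ∃ V : Fin n → Fin d → ℝ, IsFlatTight (324 * Real.log (2 * (N : ℝ) ^ 2) / d) V := by
  have hdR : (2 : ℝ) ≤ d := by exact_mod_cast hd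
  have hNR : (2 : ℝ) * d + 1 ≤ N := by exact_mod_cast hN
  have block : ∀ h, d ≤ h → h < 4 * d → ∃ V : Fin (2 * h + 1) → Fin d → ℝ,
      IsFlatTight (324 * Real.log (2 * (N : ℝ) ^ 2) / d) V := by
    intro h h1 h2
    obtain ⟨V, hV⟩ := exists_isFlatTight_of_odd hd h1 h2
    refine ⟨V, hV.mono ?_⟩
    have : Real.log (16 * d) ≤ Real.log (2 * (N : ℝ) ^ 2) :=
      Real.log_le_log (by linarith) (by nlinarith)
    gcongr
  induction n using Nat.strong_induction_on with
  | _ n ih =>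
    by_cases hcase : n % 2 = 1 ∧ n ≤ 8 * d
    · obtain ⟨h, rfl⟩ : ∃ h, n = 2 * h + 1 := ⟨n / 2, by omega⟩
      exact block h (by omega) (by omega)
    · obtain ⟨k, rfl⟩ : ∃ k, n = k + (2 * d + 1) := ⟨n - (2 * d + 1), by omega⟩
      obtain ⟨V, hV⟩ := ih k (by omega) (by omega) (by omega)
      obtain ⟨W, hW⟩ := block d le_rfl (by omega)
      obtain ⟨U, hU⟩ := hV.exists_sum (by omega) hW (by
        rw [Fintype.card_fin, Fintype.card_fin]
        have hk : 0 < k := by omega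
        have h1 : k * (2 * d + 1) ≤ N * N := Nat.mul_le_mul (by omega) hN
        have h2 : ((k * (2 * d + 1) : ℕ) : ℝ) ≤ (N : ℝ) ^ 2 := by
          rw [sq]; exact_mod_cast h1
        have h3 : Real.log (2 * (k * (2 * d + 1) : ℕ)) ≤ Real.log (2 * (N : ℝ) ^ 2) :=
          Real.log_le_log (by positivity) (by linarith)
        have h4 : 0 ≤ Real.log (2 * (N : ℝ) ^ 2) := Real.log_nonneg (by nlinarith)
        exact div_le_div_of_nonneg_right (by linarith) (by linarith))
      exact ⟨_, hU.reindex finSumFinEquiv.symm⟩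

/-! ### From coordinates to doubly balanced frames -/

theorem isDoublyBalanced_of_tight {n d : ℕ} {U : Frame n d} (hu : ∀ i, ‖U i‖ = 1)
    (ht : ∀ j j', ∑ i, U i j * U i j' = if j = j' then (n : ℝ) / d else 0) :
    IsDoublyBalanced U := by
  have hs : size U = n := by simp [size, hu]
  have hF : frameOperator U = ((n : ℝ) / d) • (1 : Matrix (Fin d) (Fin d) ℝ) := by
    ext j j'
    rw [frameOperator, Matrix.sum_apply]
    simp only [Matrix.vecMulVec_apply, ht, Matrix.smul_apply, Matrix.one_apply, smul_eq_mul,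
      mul_ite, mul_one, mul_zero]
  have hn : normMatrix U = ((n : ℝ) / n) • (1 : Matrix (Fin n) (Fin n) ℝ) := by
    ext i i'
    have : (n : ℝ) ≠ 0 := by
      have := i.pos
      positivity
    simp [normMatrix, hu, div_self this, Matrix.one_apply, Matrix.diagonal_apply]
  constructor <;> simp only [hs, hF, hn, sub_zero, add_zero, one_mul, sub_self] <;>
    exact Matrix.PosSemidef.zero

theorem angle_le_of_forall {n d : ℕ} {U : Frame n d} {B : ℝ} (hB : 0 ≤ B)
    (h : ∀ i i', i ≠ i' → (inner ℝ (U i) (U i')) ^ 2 ≤ B) : angle U ≤ B :=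
  Real.iSup_le (fun p => h _ _ p.2) hB

theorem angle_le_one {n d : ℕ} {U : Frame n d} (hu : ∀ i, ‖U i‖ = 1) : angle U ≤ 1 := by
  refine angle_le_of_forall zero_le_one fun i i' _ => ?_
  rw [sq_le_one_iff_abs_le_one]
  simpa [hu] using abs_real_inner_le_norm (U i) (U i')

/-- `k` copies of the standard basis of `ℝ^d`. -/
theorem exists_isDoublyBalanced_mul (k d : ℕ) (hd : 0 < d) :
    ∃ V : Frame (k * d) d, IsDoublyBalanced V ∧ ∀ i, ‖V i‖ = 1 := by
  set V : Frame (k * d) d := fun i => EuclideanSpace.single (finProdFinEquiv.symm i).2 (1 : ℝ)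
    with hV
  have hu : ∀ i, ‖V i‖ = 1 := fun i => by simp [hV]
  refine ⟨V, isDoublyBalanced_of_tight hu fun j j' => ?_, hu⟩
  have hd0 : (d : ℝ) ≠ 0 := by positivity
  rw [← finProdFinEquiv.sum_comp, Fintype.sum_prod_type]
  simp only [hV, Equiv.symm_apply_apply, PiLp.single_apply]
  split_ifs with h
  · subst h
    simp [hd0]
  · refine sum_eq_zero fun _ _ => sum_eq_zero fun x _ => ?_
    by_cases h1 : j = x
    · have : j' ≠ x := fun h2 => h (h1.trans h2.symm)
      simp [this]
    · simp [h1]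

/-- Unit norm tight frames of coherence `O(√(log n / d))` exist for all `n ≥ 4 d + 2`. -/
theorem exists_isDoublyBalanced_angle_le {n d : ℕ} (hd : 2 ≤ d) (hn : 4 * d + 2 ≤ n) :
    ∃ V : Frame n d, IsDoublyBalanced V ∧ (∀ i, ‖V i‖ = 1) ∧
      angle V ≤ 972 * (Real.log n / d) := by
  obtain ⟨V, hV⟩ := exists_isFlatTight (N := n) hd (by omega) n le_rfl ⟨by omega, Or.inr hn⟩
  have hu : ∀ i, ‖(WithLp.toLp 2 (V i) : EuclideanSpace ℝ (Fin d))‖ = 1 := fun i => by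
    rw [EuclideanSpace.norm_eq]
    simp [hV.unit]
  have hnR : (2 : ℝ) ≤ n := by exact_mod_cast (by omega : 2 ≤ n)
  -- The factor 3 turns 324 into 972.
  have hlog : Real.log (2 * (n : ℝ) ^ 2) ≤ 3 * Real.log n := by
    rw [Real.log_mul two_ne_zero (by positivity), Real.log_pow]
    have := Real.log_le_log two_pos hnR
    push_cast
    linarith
  have hlog0 : 0 ≤ Real.log n := Real.log_nonneg (by linarith)
  refine ⟨fun i => WithLp.toLp 2 (V i), isDoublyBalanced_of_tight hu fun j j' => ?_, hu, ?_⟩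
  · simpa using hV.tight j j'
  · refine angle_le_of_forall (by positivity) fun i i' h => ?_
    have h1 := hV.coherence i' i h.symm
    have e : inner ℝ (WithLp.toLp 2 (V i) : EuclideanSpace ℝ (Fin d)) (WithLp.toLp 2 (V i'))
        = ∑ j, V i' j * V i j := by
      simp [PiLp.inner_apply]
    rw [e]
    refine h1.trans ?_
    rw [← mul_div_assoc]
    exact div_le_div_of_nonneg_right (by linarith) (Nat.cast_nonneg _)

end FrameScaling

theorem theoremt :
    ∃ c : ℝ, 0 < c ∧ ∃ C : ℝ, 0 < C ∧
      (∀ d n : ℕ, 1 ≤ d → c * (d : ℝ) ^ ((4 : ℝ) / 3) ≤ (n : ℝ) →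
        ∃ V : FrameScaling.Frame n d,
          FrameScaling.IsDoublyBalanced V ∧ (∀ i, ‖V i‖ = 1) ∧
          FrameScaling.angle V ≤
            C * (Real.log (n : ℝ) / (d : ℝ)
              + (d : ℝ) * Real.log (d : ℝ) ^ 3 / (n : ℝ))) ∧
      (∀ d : ℕ, 1 ≤ d →
        ∃ V : FrameScaling.Frame (d ^ 2) d,
          FrameScaling.IsDoublyBalanced V ∧ (∀ i, ‖V i‖ = 1) ∧
          FrameScaling.angle V ≤ C * (Real.log (d : ℝ) ^ 3 / (d : ℝ))) := by
  have hl2 : 0.69 < Real.log 2 := by linarith [Real.log_two_gt_d9]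
  -- `6 * d ≥ 4 * d + 2` for `d ≥ 1`. In part (2), 6000 absorbs `2 * 972 / log d ^ 2` for `d ≥ 5`
  -- and `d / log d ^ 3` for `d = 2, 3, 4`.
  refine ⟨6, by norm_num, 6000, by norm_num, fun d n hd hn => ?_, fun d hd => ?_⟩
  · have hdR : (1 : ℝ) ≤ d := by exact_mod_cast hd
    have hlogd : 0 ≤ Real.log d := Real.log_nonneg hdR
    have hpow : (d : ℝ) ≤ (d : ℝ) ^ ((4 : ℝ) / 3) :=
      Real.self_le_rpow_of_one_le hdR (by norm_num)
    have h6 : 6 * d ≤ n := by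
      have : (6 : ℝ) * d ≤ n := by linarith
      exact_mod_cast this
    have hn2 : (2 : ℝ) ≤ n := by exact_mod_cast (by omega : 2 ≤ n)
    have hlogn := Real.log_le_log two_pos hn2
    have hextra : 0 ≤ (d : ℝ) * Real.log d ^ 3 / n := by positivity
    have hmain : 0 ≤ Real.log n / d := div_nonneg (by linarith) (by linarith)
    rcases hd.eq_or_lt with rfl | hd2
    · have h1 := FrameScaling.exists_isDoublyBalanced_mul n 1 one_pos
      rw [mul_one] at h1
      obtain ⟨V, hV, hu⟩ := h1
      refine ⟨V, hV, hu, (FrameScaling.angle_le_one hu).trans ?_⟩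
      rw [Nat.cast_one, div_one] at hmain ⊢
      simp
      linarith
    · obtain ⟨V, hV, hu, ha⟩ :=
        FrameScaling.exists_isDoublyBalanced_angle_le hd2 (by omega : 4 * d + 2 ≤ n)
      exact ⟨V, hV, hu, ha.trans (by linarith)⟩
  · rcases le_or_gt 5 d with h5 | h5
    · obtain ⟨V, hV, hu, ha⟩ :=
        FrameScaling.exists_isDoublyBalanced_angle_le (by omega : 2 ≤ d)
          (by nlinarith : 4 * d + 2 ≤ d ^ 2)
      refine ⟨V, hV, hu, ha.trans ?_⟩
      have hdR : (2 : ℝ) ≤ d := by exact_mod_cast (by omega : 2 ≤ d)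
      have hl := hl2.trans_le (Real.log_le_log two_pos hdR)
      rw [Nat.cast_pow, Real.log_pow, ← mul_div_assoc, ← mul_div_assoc]
      refine div_le_div_of_nonneg_right ?_ (by linarith)
      push_cast
      have h1 : 0.47 ≤ Real.log d ^ 2 := by nlinarith
      nlinarith
    -- Here `d ^ 2 < 4 * d + 2`, and for `d ≥ 2` the trivial bound 1 on the angle is enough.
    · rw [sq d]
      obtain ⟨V, hV, hu⟩ := FrameScaling.exists_isDoublyBalanced_mul d d hd
      refine ⟨V, hV, hu, ?_⟩
      rcases hd.eq_or_lt with rfl | hd2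
      -- For `d = 1` the bound is 0, and a single vector has no pairs.
      · refine FrameScaling.angle_le_of_forall (by simp) fun i i' h => ?_
        exact absurd (Fin.ext (by omega)) h
      · refine (FrameScaling.angle_le_one hu).trans ?_
        have hdR : (2 : ℝ) ≤ d := by exact_mod_cast hd2
        have hdR' : (d : ℝ) ≤ 5 := by exact_mod_cast h5.le
        have hl := hl2.trans_le (Real.log_le_log two_pos hdR)
        have h1 : (0.69 : ℝ) ^ 3 ≤ Real.log d ^ 3 := by gcongr
        rw [← mul_div_assoc, le_div_iff₀ (by linarith)]
        linarith
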